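/- \textbf{Setting.} Consider a network game with players $1,\dots,N$, where player $i$ has pure strategies $\{0,1,\dots,k_i\}$, and with a directed graph on the players such that the payoff $u_i$ of player $i$ depends only on the strategies of the players in $\mathcal N_i=\{j : j\to i\}\cup\{i\}$. Payoffs lie in a field $K$ with a valuation $\mathrm{val}:K\to\mathbb R\cup\{\infty\}$. Let $x_{j,t}$ be the probability that player $j$ plays $t$, and eliminate $x_{j,0}=1-\sum_{t\ge1}x_{j,t}$. Put $\Omega=\{(i,s):1\le i\le N,\ 1\le s\le k_i\}$ and $d=|\Omega|=\sum_i k_i$. The indifference equations are $f_{i,s}=u_i(s,\mathbf x_{-i})-u_i(0,\mathbf x_{-i})=\sum_u c_{(i,s),u}\,x^u$, for $(i,s)\in\Omega$, where $u_i(s,\mathbf x_{-i})$ is the expected payoff. Let $P_{i,s}\subset\mathbb R^d$ be the Newton polytope of $f_{i,s}$. The polynomial graph $G_{\mathrm{poly}}$ is the directed graph on $\Omega$ with an arc $(i,s)\to(j,t)$ whenever $x_{j,t}$ appears in $f_{i,s}$. A disjoint cycle cover of it is a set of vertex-disjoint directed cycles that visit every vertex exactly once; equivalently, a permutation $C$ of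 $\Omega$ such that $a\to C(a)$ is an arc for every $a\in\Omega$. Given heights $h_a:\mathrm{supp}(f_a)\to\mathbb R$ $(a\in\Omega)$, let $F_a^h(w)$ be the convex hull of the exponents $u\in\mathrm{supp}(f_a)$ that minimize $h_a(u)+\langle w,u\rangle$. The sums $\sum_a F_a^h(w)$, $w\in\mathbb R^d$, with their summands labelled, are the cells of a coherent (regular) mixed subdivision of $\sum_aP_a$; such a cell is called a full-dimensional mixed cell if it has dimension $d$. For $h_a(u)=\mathrm{val}(c_{a,u})$, write $F_a(w)=F_a^h(w)$; the resulting subdivision is the one induced by the payoffs. The tropical hypersurface $\mathrm{trop}(V(f_a))$ is the set of $w$ at which $\min_u(\mathrm{val}(c_{a,u})+\langle w,u\rangle)$ is attained at least twice, with its usual polyhedral complex structure. The stable intersection of these hypersurfaces is the union of all intersections $\bigcap_a\sigma_a$ of cells $\sigma_a$ of $\mathrm{trop}(V(f_a))$ whose parallel linear spaces meet transversally. \textbf{Theorem.} Assume that the payoffs are generic: in each $f_{i,s}$ every monomial $\prod_{j\in\mathcal N_i\setminus\{i\}}x_{j,p_j}$ with $0\le p_j\le k_j$ (where $x_{j,0}$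 is read as $1$) has a non-zero coefficient, and the regular mixed subdivision induced by the payoffs is fine and nondegenerate, i.e. for every $w$ the Cayley points $(e_a,u)$, with $a\in\Omega$ and $u$ an exponent of $f_a$ minimizing $\mathrm{val}(c_{a,u})+\langle w,u\rangle$, are affinely independent. (1) Let $w$ be a point of the stable intersection of the hypersurfaces $\mathrm{trop}(V(f_{i,s}))$. Then $\sum_aF_a(w)$ is a full-dimensional mixed cell, every $F_a(w)$ is one-dimensional, and this cell determines a disjoint cycle cover of $G_{\mathrm{poly}}$: there is a disjoint cycle cover $C$ such that, for each $a\in\Omega$, the coordinate of the variable $x_{C(a)}$ is not constant on the edge $F_a(w)$. If, moreover, each edge $F_a(w)$ is parallel to the coordinate block of a single player, then $C$ is unique. (2) Conversely, every disjoint cycle cover $C$ of $G_{\mathrm{poly}}$ gives rise to one-dimensional faces $F_{i,s}$ of $P_{i,s}$, $(i,s)\in\Omega$, of the following form: if $C(i,s)=(j,t)$, then $j\in\mathcal N_i\setminus\{i\}$ and $F_{i,s}$ is the sum of the edge $[e_{j,0},e_{j,t}]$ of the simplex $\Delta_{k_j}=\mathrm{conv}\{e_{j,0},\dots,e_{j,k_j}\}$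 and of one vertex of each $\Delta_{k_{j'}}$, $j'\in\mathcal N_i\setminus\{i,j\}$. Here $e_{j,0}=0$ and $e_{j,t}$ is the unit vector of $x_{j,t}$. Moreover, there are heights on the supports of the $f_{i,s}$ such that $\sum_{(i,s)}F_{i,s}$, with these summands, is a full-dimensional mixed cell of the induced coherent regular mixed subdivision of the family $\{P_{i,s}\}$. -/

import Mathlib

open scoped Pointwise

noncomputable section

namespace TropicalGame

/-! ### Network games and their indifference equations -/

/-- A network game with players `Fin N` and payoffs in `K`. Player `i` has the pure strategies
`0, 1, …, k i`. An arc `j → i` of `graph` means that the payoff of `i` may depend on the strategy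
of `j`; besides that it may depend on the strategy of `i` itself. -/
structure NetworkGame (N : ℕ) (k : Fin N → ℕ) (K : Type*) where
  graph : Digraph (Fin N)
  payoff : Fin N → (∀ j, Fin (k j + 1)) → K
  payoff_local : ∀ i p q, (∀ j, j = i ∨ graph.Adj j i → p j = q j) → payoff i p = payoff i q

/-- The index set of the variables `x_{j,t}` and of the equations `f_{i,s}`. The element `⟨i, s⟩`,
with `s : Fin (k i)`, stands for the non-zero pure strategy `s.succ` of player `i`. -/
abbrev Idx {N : ℕ} (k : Fin N → ℕ) : Type := Σ i : Fin N, Fin (k i)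

/-- The vector space `ℝ^d`, `d = ∑ i, k i`, of exponents and of weights. -/
abbrev Space {N : ℕ} (k : Fin N → ℕ) : Type := Idx k → ℝ

section Game

variable {N : ℕ} {k : Fin N → ℕ} {K : Type*} [Field K]

/-- The probability that player `j` plays `t`, after eliminating `x_{j,0} = 1 - ∑ t, x_{j,t}`. -/
def prob (K : Type*) [Field K] (j : Fin N) (t : Fin (k j + 1)) : MvPolynomial (Idx k) K :=
  Fin.cases (1 - ∑ s : Fin (k j), MvPolynomial.X (⟨j, s⟩ : Idx k))
    (fun s => MvPolynomial.X (⟨j, s⟩ : Idx k)) t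

/-- The expected payoff `u_i(s, x_{-i})` of player `i` for the pure strategy `s`. -/
def expectedPayoff (g : NetworkGame N k K) (i : Fin N) (s : Fin (k i + 1)) :
    MvPolynomial (Idx k) K :=
  ∑ p : (∀ j, Fin (k j + 1)) with p i = s,
    MvPolynomial.C (g.payoff i p) * ∏ j ∈ Finset.univ.erase i, prob K j (p j)

/-- The indifference equation `f_{i,s} = u_i(s, x_{-i}) - u_i(0, x_{-i})`. -/
def indifference (g : NetworkGame N k K) (a : Idx k) : MvPolynomial (Idx k) K :=
  expectedPayoff g a.1 a.2.succ - expectedPayoff g a.1 0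

/-- The polynomial graph: there is an arc `(i,s) → (j,t)` iff `x_{j,t}` appears in `f_{i,s}`. -/
def polyGraph (g : NetworkGame N k K) : Digraph (Idx k) where
  Adj a b := b ∈ (indifference g a).vars

/-- The neighbours of player `i` other than `i` itself. -/
def opponents (g : NetworkGame N k K) (i : Fin N) : Finset (Fin N) :=
  open Classical in Finset.univ.filter (fun j => j ≠ i ∧ g.graph.Adj j i)

/-- The exponent `e_{j,t}` of a pure strategy `t` of player `j`, where `e_{j,0} = 0`. These are the
vertices of the simplex `Δ_{k_j}` in the coordinate block of player `j`. -/
def stratExp (j : Fin N) (t : Fin (k j + 1)) : Idx k →₀ ℕ :=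
  Fin.cases 0 (fun s => Finsupp.single (⟨j, s⟩ : Idx k) 1) t

end Game

/-- A disjoint cycle cover of a finite directed graph: a permutation of the vertices that moves
each vertex along an arc. The cycles of the permutation are the vertex-disjoint directed cycles,
which together visit every vertex exactly once. -/
def IsCycleCover {V : Type*} (G : Digraph V) (C : Equiv.Perm V) : Prop :=
  ∀ v, G.Adj v (C v)

/-! ### Polytopes, regular mixed subdivisions -/

section Polyhedral

variable {ι : Type*} [Fintype ι]

/-- The dimension of a subset of `ℝ^ι`, that is, of its affine hull. -/
def dim (S : Set (ι → ℝ)) : ℕ := Module.finrank ℝ (vectorSpan ℝ S)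

/-- An exponent vector as a point of `ℝ^ι`. -/
def toPoint (u : ι →₀ ℕ) : ι → ℝ := fun a => (u a : ℝ)

/-- The Newton polytope of a polynomial. -/
def newtonPolytope {K : Type*} [CommSemiring K] (f : MvPolynomial ι K) : Set (ι → ℝ) :=
  convexHull ℝ (toPoint '' (f.support : Set (ι →₀ ℕ)))

/-- The face of `P` on which `⟨w, ·⟩` is minimal. -/
def face (w : ι → ℝ) (P : Set (ι → ℝ)) : Set (ι → ℝ) :=
  {x | x ∈ P ∧ ∀ y ∈ P, w ⬝ᵥ x ≤ w ⬝ᵥ y}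

/-- The exponents `u ∈ A` at which `h u + ⟨w, u⟩` is minimal. -/
def lowerSet (A : Finset (ι →₀ ℕ)) (h : (ι →₀ ℕ) → ℝ) (w : ι → ℝ) : Finset (ι →₀ ℕ) :=
  open Classical in
  A.filter (fun u => ∀ u' ∈ A, h u + w ⬝ᵥ toPoint u ≤ h u' + w ⬝ᵥ toPoint u')

/-- The cell with weight `w` of the regular subdivision of `conv A` with heights `h`: the projection
of the face of the lifted polytope on which `(w, 1)` is minimal. -/
def lowerFace (A : Finset (ι →₀ ℕ)) (h : (ι →₀ ℕ) → ℝ) (w : ι → ℝ) : Set (ι → ℝ) :=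
  convexHull ℝ (toPoint '' (lowerSet A h w : Set (ι →₀ ℕ)))

/-- `∑ a, F a` is, with these summands, a full-dimensional mixed cell of the regular (coherent)
mixed subdivision of `∑ a, conv (A a)` that is induced by the heights `h`. -/
def IsFullMixedCell (A : ι → Finset (ι →₀ ℕ)) (h : ι → (ι →₀ ℕ) → ℝ) (F : ι → Set (ι → ℝ)) :
    Prop :=
  (∃ w : ι → ℝ, ∀ a, F a = lowerFace (A a) (h a) w) ∧ dim (∑ a, F a) = Fintype.card ι

/-- The regular mixed subdivision of `∑ a, conv (A a)` induced by the heights `h` is fine (and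
nondegenerate): under the Cayley trick its cells are simplices, that is, for each weight `w` the
points `(e_a, u)`, with `u` in the cell of `A a`, are affinely independent. -/
def IsFineMixedSubdivision (A : ι → Finset (ι →₀ ℕ)) (h : ι → (ι →₀ ℕ) → ℝ) : Prop :=
  open Classical in
  ∀ w : ι → ℝ, AffineIndependent ℝ
    (fun q : (Σ a : ι, {u // u ∈ lowerSet (A a) (h a) w}) =>
      ((Pi.single q.1 1, toPoint q.2.1) : (ι → ℝ) × (ι → ℝ)))

/-! ### Tropical hypersurfaces and their stable intersection -/

variable {K : Type*} [Field K]

/-- The heights `u ↦ val (c_u)` of a polynomial `∑ u, c_u x^u`; only their values on the support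
are ever used. -/
def valHeight (v : AddValuation K (WithTop ℝ)) (f : MvPolynomial ι K) (u : ι →₀ ℕ) : ℝ :=
  (v (f.coeff u)).untopD 0

/-- The exponents at which the minimum `trop(f)(w) = min_u (val (c_u) + ⟨w, u⟩)` is attained. -/
def initSupport (v : AddValuation K (WithTop ℝ)) (f : MvPolynomial ι K) (w : ι → ℝ) :
    Finset (ι →₀ ℕ) :=
  lowerSet f.support (valHeight v f) w

/-- The initial face of `f` at `w`: the convex hull of the exponents of the initial form. -/
def initFace (v : AddValuation K (WithTop ℝ)) (f : MvPolynomial ι K) (w : ι → ℝ) :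
    Set (ι → ℝ) :=
  lowerFace f.support (valHeight v f) w

/-- The tropical hypersurface `trop(V(f))`: the minimum is attained at least twice. -/
def tropHypersurface (v : AddValuation K (WithTop ℝ)) (f : MvPolynomial ι K) : Set (ι → ℝ) :=
  {w | 2 ≤ (initSupport v f w).card}

/-- The cells of the polyhedral complex `trop(V(f))` (dual to the regular subdivision of the
Newton polytope): the cell with relative interior point `w₀ ∈ trop(V(f))` consists of all `w` at
which at least all the terms that are minimal at `w₀` are minimal. -/
def IsTropCell (v : AddValuation K (WithTop ℝ)) (f : MvPolynomial ι K) (σ : Set (ι → ℝ)) : Prop :=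
  ∃ w₀ ∈ tropHypersurface v f, σ = {w | initSupport v f w₀ ⊆ initSupport v f w}

/-- The linear spaces parallel to the cells `σ a` meet transversally: the codimension of their
intersection is the sum of their codimensions. (For two cells: `dim (σ₁ + σ₂)` is the dimension of
the ambient space.) -/
def MeetTransversally (σ : ι → Set (ι → ℝ)) : Prop :=
  Module.finrank ℝ ↥(⨅ a, vectorSpan ℝ (σ a)) +
    ∑ a, Module.finrank ℝ ((ι → ℝ) ⧸ vectorSpan ℝ (σ a)) = Module.finrank ℝ (ι → ℝ)

/-- The stable intersection of the tropical hypersurfaces `trop(V(f a))`: the union of all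
intersections of cells, one of each hypersurface, that meet transversally. -/
def stableIntersection (v : AddValuation K (WithTop ℝ)) (f : ι → MvPolynomial ι K) :
    Set (ι → ℝ) :=
  {w | ∃ σ : ι → Set (ι → ℝ), (∀ a, IsTropCell v (f a) (σ a)) ∧ MeetTransversally σ ∧
    ∀ a, w ∈ σ a}

end Polyhedral

/-! ### Genericity, and faces attached to cycle covers -/

section Generic

variable {N : ℕ} {k : Fin N → ℕ} {K : Type*} [Field K]

/-- The payoffs are generic: every monomial `∏ x_{j,p_j}` (`j` over the opponents of `i`,
`x_{j,0}` read as `1`) has a non-zero coefficient in `f_{i,s}`, and the regular mixed subdivision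
that the valuations of the coefficients induce is fine and nondegenerate. -/
structure IsGeneric (v : AddValuation K (WithTop ℝ)) (g : NetworkGame N k K) : Prop where
  coeff_ne_zero : ∀ (a : Idx k) (p : ∀ j, Fin (k j + 1)),
    (indifference g a).coeff (∑ j ∈ opponents g a.1, stratExp j (p j)) ≠ 0
  fine : IsFineMixedSubdivision (fun a => (indifference g a).support)
    (fun a => valHeight v (indifference g a))

/-- The coordinate `b` is not constant on `F`. -/
def Involves (F : Set (Space k)) (b : Idx k) : Prop :=
  ∃ x ∈ F, ∃ y ∈ F, x b ≠ y b

/-- `F` is parallel to the coordinate block of a single player. -/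
def InSingleBlock (F : Set (Space k)) : Prop :=
  ∃ j : Fin N, ∀ x ∈ F, ∀ y ∈ F, ∀ b : Idx k, b.1 ≠ j → x b = y b

/-- `F` is the admissible one-dimensional face of `∑_{j'} Δ_{k_j'}` (sum over the opponents `j'` of
player `i`) that consists of the edge `[e_{j,t}, e_{j,t'}]` of the block `Δ_{k_j}` and of one
vertex of each of the other blocks. -/
def IsAdmissibleFace (g : NetworkGame N k K) (i j : Fin N) (t t' : Fin (k j + 1))
    (F : Set (Space k)) : Prop :=
  j ∈ opponents g i ∧ t ≠ t' ∧ ∃ p : ∀ j', Fin (k j' + 1),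
    F = segment ℝ (toPoint (stratExp j t)) (toPoint (stratExp j t')) +
      {∑ j' ∈ (opponents g i).erase j, toPoint (stratExp j' (p j'))}

end Generic

end TropicalGame

end

/-! Both directions are linear algebra on the d×d matrix whose rows are the directions of the edges
`F_a`.

Let `w` be a stable point. There are d hypersurfaces in dimension d, so transversality forces each
chosen cell to have codimension exactly one and the parallel hyperplanes to meet only in 0. By the
Cayley trick, fineness allows at most 2d minimizing exponents in total, so every initial form has
exactly two terms, and the edge directions form a nonsingular matrix
(`exists_edges_of_mem_stableIntersection`). Nonsingularity gives full dimension, and any non-zero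
Leibniz term of the determinant is a permutation `C` along which the edges vary, hence a cycle
cover.

If every edge lies in one block, each row is `±e_b` or `e_b - e_c`
(`apply_sub_apply_of_same_block`), as in a reduced incidence matrix of a graph. Two different
non-zero Leibniz terms would make some rows dependent (`perm_eq_of_rows`), so `C` is unique.

Conversely, a cover `C` yields the edges from 0 to `e_{C(a)}`. Their directions are the permuted
unit vectors, and heights 0 on the endpoints and 1 elsewhere select exactly these edges. -/

namespace TropicalGame

open MvPolynomial

/-! ### Exponents of the indifference equations: vertices of products of simplices. -/

section Support

variable {N : ℕ} {k : Fin N → ℕ} {K : Type*} [Field K]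

theorem stratExp_apply_self (b : Idx k) (t : Fin (k b.1 + 1)) :
    stratExp b.1 t b = if t = b.2.succ then 1 else 0 := by
  obtain ⟨j, s⟩ := b
  induction t using Fin.cases with
  | zero => simp [stratExp, (Fin.succ_ne_zero s).symm]
  | succ s' =>
    by_cases h : s' = s
    · simp [stratExp, h]
    · simp [stratExp, h]

theorem stratExp_apply_of_ne {b : Idx k} {j : Fin N} (t : Fin (k j + 1)) (h : b.1 ≠ j) :
    stratExp j t b = 0 := by
  induction t using Fin.cases with
  | zero => simp [stratExp]
  | succ s =>
    have : (⟨j, s⟩ : Idx k) ≠ b := fun e => h (by rw [← e])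
    simp [stratExp, this]

/-- The blocks of different players are disjoint, so only the summand of player `b.1` can contribute
at `b`. -/
theorem sum_stratExp_apply (O : Finset (Fin N)) (p : ∀ j, Fin (k j + 1)) (b : Idx k) :
    (∑ j ∈ O, stratExp j (p j)) b = if b.1 ∈ O ∧ p b.1 = b.2.succ then 1 else 0 := by
  rw [Finsupp.finsetSum_apply]
  by_cases hb : b.1 ∈ O
  · rw [Finset.sum_eq_single_of_mem b.1 hb
      (fun j _ hj => stratExp_apply_of_ne (p j) (Ne.symm hj)), stratExp_apply_self]
    simp [hb]
  · rw [Finset.sum_eq_zero (fun j hj => stratExp_apply_of_ne (p j)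
      (fun e => hb (e ▸ hj)))]
    simp [hb]

theorem sum_prob (j : Fin N) : ∑ t : Fin (k j + 1), prob K (k := k) j t = 1 := by
  rw [Fin.sum_univ_succ]
  simp [prob]

theorem exists_stratExp_of_mem_support_prob {j : Fin N} {t : Fin (k j + 1)} {u : Idx k →₀ ℕ}
    (hu : u ∈ (prob K j t).support) : ∃ t', u = stratExp j t' := by
  classical
  induction t using Fin.cases with
  | zero =>
    have hu' : u ∈ (1 - ∑ s : Fin (k j), X (⟨j, s⟩ : Idx k) : MvPolynomial (Idx k) K).support := hu
    rcases Finset.mem_union.1 (support_sub _ _ _ hu') with h | h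
    · refine ⟨0, ?_⟩
      have := support_one (R := K) (σ := Idx k) ▸ h
      simpa [stratExp] using this
    · obtain ⟨s, -, hs⟩ := Finset.mem_biUnion.1 (support_sum h)
      refine ⟨s.succ, ?_⟩
      simpa [support_X, stratExp] using hs
  | succ s =>
    refine ⟨s.succ, ?_⟩
    have hu' : u ∈ (X (⟨j, s⟩ : Idx k) : MvPolynomial (Idx k) K).support := hu
    simpa [support_X, stratExp] using hu'

theorem exists_of_mem_support_prod_prob (O : Finset (Fin N)) (q : ∀ j, Fin (k j + 1))
    {u : Idx k →₀ ℕ} (hu : u ∈ (∏ j ∈ O, prob K j (q j)).support) :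
    ∃ p : ∀ j, Fin (k j + 1), u = ∑ j ∈ O, stratExp j (p j) := by
  classical
  induction O using Finset.induction_on generalizing u with
  | empty =>
    refine ⟨q, ?_⟩
    rw [Finset.prod_empty] at hu
    have := support_one (R := K) (σ := Idx k) ▸ hu
    simpa using this
  | insert i O hi ih =>
    rw [Finset.prod_insert hi] at hu
    obtain ⟨u₁, h₁, u₂, h₂, rfl⟩ := Finset.mem_add.1 (support_mul _ _ hu)
    obtain ⟨t, rfl⟩ := exists_stratExp_of_mem_support_prob h₁
    obtain ⟨p, rfl⟩ := ih h₂
    refine ⟨Function.update p i t, ?_⟩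
    rw [Finset.sum_insert hi, Function.update_self]
    congr 1
    refine Finset.sum_congr rfl fun j hj => ?_
    rw [Function.update_of_ne (ne_of_mem_of_not_mem hj hi)]

/-- Summing out the strategies of the players on which the payoff does not depend. -/
theorem sum_prod_prob_eq (O : Finset (Fin N)) (i : Fin N) (hi : i ∉ O) (q : ∀ j, Fin (k j + 1)) :
    ∑ p : (∀ j, Fin (k j + 1)) with ∀ j, j = i ∨ j ∈ O → p j = q j,
      ∏ j ∈ Finset.univ.erase i, prob K j (p j) = ∏ j ∈ O, prob K j (q j) := by
  classical
  set T : ∀ j, Finset (Fin (k j + 1)) := fun j => if j = i ∨ j ∈ O then {q j} else Finset.univ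
  have hT : (Finset.univ.filter fun p : (∀ j, Fin (k j + 1)) =>
      ∀ j, j = i ∨ j ∈ O → p j = q j) = Fintype.piFinset T := by
    ext p
    simp only [Finset.mem_filter, Finset.mem_univ, true_and, Fintype.mem_piFinset]
    refine forall_congr' fun j => ?_
    by_cases h : j = i ∨ j ∈ O <;> simp [T, h]
  -- Giving player `i` the factor 1 extends the product to all players, so that a sum over a box of
  -- profiles factors into one sum per player.
  have hprod : ∀ p : (∀ j, Fin (k j + 1)), ∏ j ∈ Finset.univ.erase i, prob K j (p j) =
      ∏ j, if j = i then 1 else prob K j (p j) := by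
    intro p
    rw [← Finset.mul_prod_erase Finset.univ _ (Finset.mem_univ i), if_pos rfl, one_mul]
    exact Finset.prod_congr rfl fun j hj => by rw [if_neg (Finset.ne_of_mem_erase hj)]
  rw [hT, Finset.sum_congr rfl (fun p _ => hprod p),
    ← Finset.prod_univ_sum T (fun j t => if j = i then 1 else prob K j t),
    ← Finset.prod_subset (Finset.subset_univ O)]
  · refine Finset.prod_congr rfl fun j hj => ?_
    have hji : j ≠ i := fun e => hi (e ▸ hj)
    simp [T, hj, hji]
  · intro j _ hj
    by_cases hji : j = i
    · subst hji; simp [T]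
    · simp [T, hji, hj, sum_prob]

/-- The definition multiplies over all other players. Payoffs ignore the non-opponents, whose
probabilities sum to 1 and drop out. -/
theorem exists_of_mem_support_expectedPayoff (g : NetworkGame N k K) (i : Fin N)
    (s : Fin (k i + 1)) {u : Idx k →₀ ℕ} (hu : u ∈ (expectedPayoff g i s).support) :
    ∃ p : ∀ j, Fin (k j + 1), u = ∑ j ∈ opponents g i, stratExp j (p j) := by
  classical
  have hi : i ∉ opponents g i := by simp [opponents]
  -- `r` resets the strategies that do not affect the payoff of `i`; the payoff is constant on its
  -- fibres, so each fibre can be summed out.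
  let r : (∀ j, Fin (k j + 1)) → ∀ j, Fin (k j + 1) :=
    fun p j => if j = i ∨ j ∈ opponents g i then p j else 0
  have key : expectedPayoff g i s = ∑ q : (∀ j, Fin (k j + 1)) with q i = s ∧ r q = q,
      C (g.payoff i q) * ∏ j ∈ opponents g i, prob K j (q j) := by
    unfold expectedPayoff
    rw [← Finset.sum_fiberwise_of_maps_to (g := r)
      (t := Finset.univ.filter fun q => q i = s ∧ r q = q)]
    · refine Finset.sum_congr rfl fun q hq => ?_
      obtain ⟨hqs, hrq⟩ := (Finset.mem_filter.1 hq).2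
      rw [← sum_prod_prob_eq (K := K) (opponents g i) i hi q, Finset.mul_sum]
      have hset : ((Finset.univ.filter fun p : (∀ j, Fin (k j + 1)) => p i = s).filter
          fun p => r p = q) =
          Finset.univ.filter fun p => ∀ j, j = i ∨ j ∈ opponents g i → p j = q j := by
        ext p
        simp only [Finset.mem_filter, Finset.mem_univ, true_and]
        constructor
        · rintro ⟨-, rfl⟩ j hj
          simp [r, hj]
        · intro h
          refine ⟨(h i (Or.inl rfl)).trans hqs, ?_⟩
          rw [← hrq]
          funext j
          by_cases hj : j = i ∨ j ∈ opponents g i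
          · simp [r, hj, h j hj]
          · simp [r, hj]
      rw [hset]
      refine Finset.sum_congr rfl fun p hp => ?_
      rw [g.payoff_local i p q]
      intro j hj
      refine (Finset.mem_filter.1 hp).2 j ?_
      by_cases hji : j = i
      · exact Or.inl hji
      · exact Or.inr (by simpa [opponents, hji] using hj)
    · intro p hp
      have hp' : p i = s := (Finset.mem_filter.1 hp).2
      refine Finset.mem_filter.2 ⟨Finset.mem_univ _, by simp [r, hp'], ?_⟩
      funext j
      by_cases hj : j = i ∨ j ∈ opponents g i <;> simp [r, hj]
  rw [key] at hu
  obtain ⟨q, -, hq⟩ := Finset.mem_biUnion.1 (support_sum hu)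
  refine exists_of_mem_support_prod_prob (K := K) _ q ?_
  rw [mem_support_iff, coeff_C_mul] at hq
  exact mem_support_iff.2 (right_ne_zero_of_mul hq)

theorem exists_of_mem_support_indifference (g : NetworkGame N k K) (a : Idx k)
    {u : Idx k →₀ ℕ} (hu : u ∈ (indifference g a).support) :
    ∃ p : ∀ j, Fin (k j + 1), u = ∑ j ∈ opponents g a.1, stratExp j (p j) := by
  classical
  rcases Finset.mem_union.1 (support_sub _ _ _ hu) with h | h <;>
    exact exists_of_mem_support_expectedPayoff g _ _ h

theorem apply_le_one_of_mem_support (g : NetworkGame N k K) (a : Idx k)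
    {u : Idx k →₀ ℕ} (hu : u ∈ (indifference g a).support) (b : Idx k) : u b ≤ 1 := by
  obtain ⟨p, rfl⟩ := exists_of_mem_support_indifference g a hu
  rw [sum_stratExp_apply]
  split_ifs <;> simp

/-- An edge of the support of `f_a` in a single block has a direction of the form `e_b - e_c`:
if two coordinates are involved, then they add up to zero and all others vanish. -/
theorem apply_sub_apply_of_same_block (g : NetworkGame N k K) (a : Idx k)
    {u u' : Idx k →₀ ℕ} (hu : u ∈ (indifference g a).support)
    (hu' : u' ∈ (indifference g a).support) {j : Fin N}
    (hj : ∀ b : Idx k, b.1 ≠ j → u b = u' b) {b c : Idx k} (hbc : b ≠ c) (hb : u b ≠ u' b)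
    (hc : u c ≠ u' c) :
    (u' b : ℝ) - u b + (u' c - u c) = 0 ∧ ∀ e, e ≠ b → e ≠ c → u e = u' e := by
  obtain ⟨p, rfl⟩ := exists_of_mem_support_indifference g a hu
  obtain ⟨p', rfl⟩ := exists_of_mem_support_indifference g a hu'
  have hbj : b.1 = j := by by_contra h; exact hb (hj b h)
  have hcj : c.1 = j := by by_contra h; exact hc (hj c h)
  obtain ⟨j₁, b⟩ := b
  obtain ⟨j₂, c⟩ := c
  obtain rfl : j₁ = j := hbj
  obtain rfl : j₂ = j₁ := hcj
  have hbc' : b ≠ c := fun h => hbc (by rw [h])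
  -- Exponents are 0/1 indicators of profiles: a coordinate differs only where exactly one of `p`,
  -- `p'` plays it.
  have key : ∀ e : Idx k, e.1 ∈ opponents g a.1 ∧ (p e.1 = e.2.succ ↔ ¬ p' e.1 = e.2.succ) ∨
      (∑ j ∈ opponents g a.1, stratExp j (p j)) e =
        (∑ j ∈ opponents g a.1, stratExp j (p' j)) e := by
    intro e
    rw [sum_stratExp_apply, sum_stratExp_apply]
    by_cases h : e.1 ∈ opponents g a.1 <;> by_cases h1 : p e.1 = e.2.succ <;>
      by_cases h2 : p' e.1 = e.2.succ <;> simp [h, h1, h2]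
  obtain ⟨ho, hb'⟩ := (key ⟨j₂, b⟩).resolve_right hb
  obtain ⟨-, hc'⟩ := (key ⟨j₂, c⟩).resolve_right hc
  simp only at ho hb' hc'
  simp only [sum_stratExp_apply, ho, true_and]
  -- A profile plays one strategy per block. So the two differing coordinates are the strategies of
  -- `p` and `p'`, in some order, and no third one occurs.
  have hs : ∀ x : Fin (k j₂), ∀ t : Fin (k j₂ + 1), t = x.succ → ∀ y, t = y.succ → x = y := by
    intro x t h y h'
    exact Fin.succ_injective _ (h.symm.trans h')
  constructor
  · by_cases h1 : p j₂ = b.succ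
    · have h2 := hb'.1 h1
      have h3 : ¬ p j₂ = c.succ := fun h => hbc' (hs _ _ h1 _ h)
      have h4 : p' j₂ = c.succ := by by_contra h; exact h3 (hc'.2 h)
      simp only [h2, h3, if_pos h1, if_pos h4]
      norm_num
    · have h2 : p' j₂ = b.succ := by by_contra h; exact h1 (hb'.2 h)
      have h3 : ¬ p' j₂ = c.succ := fun h => hbc' (hs _ _ h2 _ h)
      have h4 := hc'.2 h3
      simp only [h1, h3, if_pos h2, if_pos h4]
      norm_num
  · intro e heb hec
    by_cases hej : e.1 = j₂
    · obtain ⟨j₃, e⟩ := e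
      obtain rfl : j₃ = j₂ := hej
      have hbe : b ≠ e := fun h => heb (by rw [h])
      have hce : c ≠ e := fun h => hec (by rw [h])
      have : ¬ p j₃ = e.succ ∧ ¬ p' j₃ = e.succ := by
        by_cases h1 : p j₃ = b.succ
        · have h3 : ¬ p j₃ = c.succ := fun h => hbc' (hs _ _ h1 _ h)
          have h4 : p' j₃ = c.succ := by by_contra h; exact h3 (hc'.2 h)
          exact ⟨fun h => hbe (hs _ _ h1 _ h), fun h => hce (hs _ _ h4 _ h)⟩
        · have h2 : p' j₃ = b.succ := by by_contra h; exact h1 (hb'.2 h)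
          have h3 : ¬ p' j₃ = c.succ := fun h => hbc' (hs _ _ h2 _ h)
          exact ⟨fun h => hce (hs _ _ (hc'.2 h3) _ h), fun h => hbe (hs _ _ h2 _ h)⟩
      simp [this]
    · have := hj e hej
      rwa [sum_stratExp_apply, sum_stratExp_apply] at this

end Support

/-! ### Dimension of sums of segments, and non-zero terms of determinants. -/

section LinearAlgebra

variable {ι : Type*}

theorem vectorSpan_segment (x y : ι → ℝ) :
    vectorSpan ℝ (segment ℝ x y) = Submodule.span ℝ {y - x} := by
  rw [← convexHull_pair, ← direction_affineSpan, affineSpan_convexHull, direction_affineSpan,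
    vectorSpan_pair_rev, vsub_eq_sub]

theorem dim_segment {x y : ι → ℝ} (h : x ≠ y) : dim (segment ℝ x y) = 1 := by
  rw [dim, vectorSpan_segment, finrank_span_singleton (sub_ne_zero.2 h.symm)]

/-- Fix a point in every other summand and vary only the one in `F a`: differences in the sum are
differences in `F a`. -/
theorem vectorSpan_le_vectorSpan_sum {κ : Type*} [Fintype κ] {F : κ → Set (ι → ℝ)}
    (hF : ∀ a, (F a).Nonempty) (a : κ) : vectorSpan ℝ (F a) ≤ vectorSpan ℝ (∑ a, F a) := by
  classical
  choose z hz using hF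
  have hmem : ∀ x ∈ F a, ∑ b, Function.update z a x b ∈ ∑ a, F a := fun x hx => by
    refine Set.finsetSum_mem_finsetSum _ _ _ fun b _ => ?_
    by_cases h : b = a
    · subst h; simpa using hx
    · simpa [h] using hz b
  rw [vectorSpan, Submodule.span_le]
  rintro _ ⟨x, hx, y, hy, rfl⟩
  have := vsub_mem_vectorSpan ℝ (hmem x hx) (hmem y hy)
  simpa [Finset.sum_update_of_mem] using this

variable [Fintype ι]

theorem dim_sum_segment_of_linearIndependent {x y : ι → ι → ℝ}
    (h : LinearIndependent ℝ fun a => y a - x a) :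
    dim (∑ a, segment ℝ (x a) (y a)) = Fintype.card ι := by
  have htop : vectorSpan ℝ (∑ a, segment ℝ (x a) (y a)) = ⊤ := by
    rw [eq_top_iff, ← h.span_eq_top_of_card_eq_finrank' (by simp), Submodule.span_le]
    rintro _ ⟨a, rfl⟩
    refine vectorSpan_le_vectorSpan_sum (F := fun a => segment ℝ (x a) (y a))
      (fun a => ⟨x a, left_mem_segment ℝ _ _⟩) a ?_
    rw [vectorSpan_segment]
    exact Submodule.mem_span_singleton_self _
  rw [dim, htop, finrank_top, Module.finrank_fintype_fun_eq_card]

theorem exists_perm_of_det_ne_zero [DecidableEq ι] {M : Matrix ι ι ℝ} (h : M.det ≠ 0) :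
    ∃ C : Equiv.Perm ι, ∀ a, M a (C a) ≠ 0 := by
  -- The Leibniz formula has entries `M (C a) a`; transposing makes `C` go from rows to columns.
  rw [← Matrix.det_transpose, Matrix.det_apply] at h
  obtain ⟨C, -, hC⟩ := Finset.exists_ne_zero_of_sum_ne_zero h
  refine ⟨C, fun a ha => hC ?_⟩
  rw [Finset.prod_eq_zero (Finset.mem_univ a) (by simpa using ha), smul_zero]

/-- A matrix with linearly independent rows, each with at most two non-zero entries, which then add
up to zero, has at most one non-zero term in its determinant. -/
theorem perm_eq_of_rows {M : Matrix ι ι ℝ} (hM : LinearIndependent ℝ M)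
    (hrow : ∀ a b c, b ≠ c → M a b ≠ 0 → M a c ≠ 0 →
      M a b + M a c = 0 ∧ ∀ e, e ≠ b → e ≠ c → M a e = 0)
    {C C' : Equiv.Perm ι} (hC : ∀ a, M a (C a) ≠ 0) (hC' : ∀ a, M a (C' a) ≠ 0) : C = C' := by
  classical
  by_contra hne
  obtain ⟨a₀, ha₀⟩ : ∃ a, C a ≠ C' a := by
    by_contra! h
    exact hne (Equiv.ext h)
  let S : Type _ := {a // C a ≠ C' a}
  -- `C` and `C'` send `S` onto the same set of columns, so both non-zero entries of a row in `S`
  -- lie in the square block `B`.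
  have hS : ∀ a : S, ∃ b : S, C b = C' a := fun a =>
    ⟨⟨C.symm (C' a), fun h => by
      rw [Equiv.apply_symm_apply] at h
      have h1 : (a : ι) = C.symm (C' a) := C'.injective h
      exact a.2 (by conv_lhs => rw [h1, Equiv.apply_symm_apply])⟩, by simp⟩
  let B : Matrix S S ℝ := fun a b => M a (C b)
  -- The rows of `B` sum to zero, hence `B` is singular.
  have hB : B.mulVec (fun _ => 1) = 0 := by
    funext a
    obtain ⟨b, hb⟩ := hS a
    obtain ⟨h1, h2⟩ := hrow a _ _ a.2 (hC a) (hC' a)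
    have hab : a ≠ b := fun h => a.2 (by rw [← hb, ← h])
    simp only [Matrix.mulVec, dotProduct, B, mul_one, Pi.zero_apply]
    rw [Fintype.sum_eq_add a b hab, hb, h1]
    rintro c ⟨hca, hcb⟩
    refine h2 _ (fun h => hca (Subtype.ext (C.injective h))) fun h => hcb ?_
    exact Subtype.ext (C.injective (h.trans hb.symm))
  have hdet : B.det = 0 := Matrix.exists_mulVec_eq_zero_iff.1
    ⟨_, fun h => one_ne_zero (congrFun h (⟨a₀, ha₀⟩ : S)), hB⟩
  -- A left kernel vector of `B` is a relation among full rows of `M`, since the rows in `S` vanish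
  -- in all columns outside `C(S)`.
  obtain ⟨x, hx, hxB⟩ := Matrix.exists_vecMul_eq_zero_iff.2 hdet
  refine hx (funext fun a => Fintype.linearIndependent_iff.1
    (hM.comp (Subtype.val : S → ι) Subtype.val_injective) x ?_ a)
  funext e
  simp only [Finset.sum_apply, Pi.smul_apply, smul_eq_mul, Function.comp]
  by_cases he : C (C.symm e) = C' (C.symm e)
  · refine Finset.sum_eq_zero fun a _ => ?_
    have h2 := (hrow a _ _ a.2 (hC a) (hC' a)).2 e
    refine mul_eq_zero_of_right _ (h2 ?_ ?_) <;> rintro rfl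
    · exact a.2 (by simpa using he)
    · obtain ⟨b, hb⟩ := hS a
      rw [← hb] at he
      exact b.2 (by simpa using he)
  · have := congrFun hxB ⟨C.symm e, he⟩
    simpa [Matrix.vecMul, dotProduct, B] using this

end LinearAlgebra

/-! ### Counting in fine mixed cells, and transversality at stable points. -/

section Cells

variable {ι : Type*}

theorem toPoint_injective : Function.Injective (toPoint : (ι →₀ ℕ) → ι → ℝ) := by
  intro u u' h
  ext a
  exact Nat.cast_injective (congrFun h a)

variable [Fintype ι]

theorem lowerFace_eq_segment {A : Finset (ι →₀ ℕ)} {h : (ι →₀ ℕ) → ℝ} {w : ι → ℝ}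
    {u u' : ι →₀ ℕ} (hA : ∀ x, x ∈ lowerSet A h w ↔ x = u ∨ x = u') :
    lowerFace A h w = segment ℝ (toPoint u) (toPoint u') := by
  have : (lowerSet A h w : Set (ι →₀ ℕ)) = {u, u'} := by
    ext x
    simpa using hA x
  rw [lowerFace, this, Set.image_pair, convexHull_pair]

theorem mem_lowerSet {A : Finset (ι →₀ ℕ)} {h : (ι →₀ ℕ) → ℝ} {w : ι → ℝ} {u : ι →₀ ℕ} :
    u ∈ lowerSet A h w ↔
      u ∈ A ∧ ∀ u' ∈ A, h u + w ⬝ᵥ toPoint u ≤ h u' + w ⬝ᵥ toPoint u' := by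
  simp [lowerSet]

theorem eq_of_mem_lowerSet {A : Finset (ι →₀ ℕ)} {h : (ι →₀ ℕ) → ℝ} {w : ι → ℝ}
    {u u' : ι →₀ ℕ} (hu : u ∈ lowerSet A h w) (hu' : u' ∈ lowerSet A h w) :
    h u + w ⬝ᵥ toPoint u = h u' + w ⬝ᵥ toPoint u' :=
  le_antisymm ((mem_lowerSet.1 hu).2 _ (mem_lowerSet.1 hu').1)
    ((mem_lowerSet.1 hu').2 _ (mem_lowerSet.1 hu).1)

/-- The cells of a fine mixed subdivision have at most `2 d` Cayley vertices. -/
theorem sum_card_lowerSet_le {A : ι → Finset (ι →₀ ℕ)} {h : ι → (ι →₀ ℕ) → ℝ}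
    (hfine : IsFineMixedSubdivision A h) (w : ι → ℝ) :
    ∑ a, (lowerSet (A a) (h a) w).card ≤ 2 * Fintype.card ι := by
  classical
  rcases isEmpty_or_nonempty ι with hι | ⟨⟨a₀⟩⟩
  · simp
  have hw := hfine w
  have hcard := hw.card_le_finrank_succ
  rw [Fintype.card_sigma] at hcard
  simp only [Fintype.card_coe] at hcard
  -- The first components of each Cayley point sum to 1. The points thus span an affine space of
  -- dimension at most 2d - 1, and independence allows at most 2d of them.
  let φ : ((ι → ℝ) × (ι → ℝ)) →ₗ[ℝ] ℝ :=
    (∑ a, LinearMap.proj a : (ι → ℝ) →ₗ[ℝ] ℝ) ∘ₗ LinearMap.fst ℝ _ _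
  have hle : vectorSpan ℝ (Set.range fun q : (Σ a : ι, {u // u ∈ lowerSet (A a) (h a) w}) =>
      ((Pi.single q.1 1, toPoint q.2.1) : (ι → ℝ) × (ι → ℝ))) ≤ LinearMap.ker φ := by
    rw [vectorSpan, Submodule.span_le]
    rintro _ ⟨_, ⟨p, rfl⟩, _, ⟨q, rfl⟩, rfl⟩
    simp [φ]
  have hlt : LinearMap.ker φ < ⊤ := by
    refine lt_top_iff_ne_top.2 fun htop => ?_
    have : ((Pi.single a₀ 1, 0) : (ι → ℝ) × (ι → ℝ)) ∈ LinearMap.ker φ := by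
      rw [htop]; trivial
    simp [φ] at this
  have h1 := Submodule.finrank_mono hle
  have h2 := Submodule.finrank_lt hlt.ne
  rw [Module.finrank_prod, Module.finrank_fintype_fun_eq_card] at h2
  exact hcard.trans (by omega)

variable {K : Type*} [Field K]

/-- At a point of the stable intersection of `d` hypersurfaces in `ℝ^d` whose mixed subdivision is
fine, each initial form has two terms, and the directions of these edges are independent. -/
theorem exists_edges_of_mem_stableIntersection [DecidableEq ι]
    {v : AddValuation K (WithTop ℝ)} {f : ι → MvPolynomial ι K}
    (hfine : IsFineMixedSubdivision (fun a => (f a).support) (fun a => valHeight v (f a)))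
    {w : ι → ℝ} (hw : w ∈ stableIntersection v f) :
    ∃ u u' : ι → ι →₀ ℕ, (∀ a, initSupport v (f a) w = {u a, u' a}) ∧
      (Matrix.of fun a => toPoint (u' a) - toPoint (u a)).det ≠ 0 := by
  obtain ⟨σ, hσ, htr, hwσ⟩ := hw
  choose w₀ hw₀ hσ using hσ
  have hedge : ∀ a, ∃ u u', u ≠ u' ∧ u ∈ initSupport v (f a) (w₀ a) ∧
      u' ∈ initSupport v (f a) (w₀ a) := fun a => by
    obtain ⟨u, hu, u', hu', hne⟩ := Finset.one_lt_card.1 (hw₀ a)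
    exact ⟨u, u', hne, hu, hu'⟩
  choose u u' hne hu hu' using hedge
  have hpt : ∀ a, toPoint (u' a) - toPoint (u a) ≠ 0 := fun a =>
    sub_ne_zero.2 fun h => hne a (toPoint_injective h).symm
  -- Two terms stay tied for minimum on all of `σ a`, so the cell is parallel to a subspace of the
  -- hyperplane orthogonal to the difference of their exponents.
  let φ : ι → (ι → ℝ) →ₗ[ℝ] ℝ := fun a => dotProductBilin ℝ ℝ (toPoint (u' a) - toPoint (u a))
  have hle : ∀ a, vectorSpan ℝ (σ a) ≤ LinearMap.ker (φ a) := fun a => by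
    rw [vectorSpan, Submodule.span_le]
    rintro _ ⟨x, hx, y, hy, rfl⟩
    rw [hσ a] at hx hy
    have e1 := eq_of_mem_lowerSet (hx (hu a)) (hx (hu' a))
    have e2 := eq_of_mem_lowerSet (hy (hu a)) (hy (hu' a))
    change (toPoint (u' a) - toPoint (u a)) ⬝ᵥ (x - y) = 0
    rw [dotProduct_comm, sub_dotProduct, dotProduct_sub, dotProduct_sub]
    linarith
  have hker : ∀ a, Module.finrank ℝ ((ι → ℝ) ⧸ LinearMap.ker (φ a)) = 1 := fun a => by
    rw [(φ a).quotKerEquivRange.finrank_eq, LinearMap.range_eq_top.2, finrank_top,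
      Module.finrank_self]
    refine LinearMap.surjective fun h => hpt a ?_
    have : φ a (toPoint (u' a) - toPoint (u a)) = 0 := by rw [h]; rfl
    exact dotProduct_self_eq_zero.1 this
  have hcodim : ∀ a, 1 ≤ Module.finrank ℝ ((ι → ℝ) ⧸ vectorSpan ℝ (σ a)) := fun a => by
    have h1 := (vectorSpan ℝ (σ a)).finrank_quotient_add_finrank
    have h2 := (LinearMap.ker (φ a)).finrank_quotient_add_finrank
    have h3 := Submodule.finrank_mono (hle a)
    have h4 := hker a
    omega
  rw [MeetTransversally, Module.finrank_fintype_fun_eq_card] at htr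
  have hsum : ∑ _a : ι, 1 ≤ ∑ a, Module.finrank ℝ ((ι → ℝ) ⧸ vectorSpan ℝ (σ a)) :=
    Finset.sum_le_sum fun a _ => hcodim a
  have hc : ∑ _a : ι, 1 = Fintype.card ι := by simp
  -- The codimensions are at least 1 and sum to at most d, so each is 1, and nothing is left for the
  -- dimension of the intersection.
  have heq : ∀ a, 1 = Module.finrank ℝ ((ι → ℝ) ⧸ vectorSpan ℝ (σ a)) := fun a =>
    (Finset.sum_eq_sum_iff_of_le fun a _ => hcodim a).1 (by omega) a (Finset.mem_univ a)
  have hspan : ∀ a, vectorSpan ℝ (σ a) = LinearMap.ker (φ a) := fun a => by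
    refine Submodule.eq_of_le_of_finrank_eq (hle a) ?_
    have h1 := (vectorSpan ℝ (σ a)).finrank_quotient_add_finrank
    have h2 := (LinearMap.ker (φ a)).finrank_quotient_add_finrank
    have h4 := hker a
    have h5 := heq a
    omega
  have hinf : ⨅ a, vectorSpan ℝ (σ a) = ⊥ := Submodule.finrank_eq_zero.1 (by omega)
  refine ⟨u, u', fun a => ?_, fun hdet => ?_⟩
  · have hsub : ∀ a, {u a, u' a} ⊆ initSupport v (f a) w := fun a => by
      have : initSupport v (f a) (w₀ a) ⊆ initSupport v (f a) w := by
        have := hwσ a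
        rwa [hσ a] at this
      intro x hx
      rcases Finset.mem_insert.1 hx with rfl | hx
      · exact this (hu a)
      · rw [Finset.mem_singleton.1 hx]
        exact this (hu' a)
    have hcard : ∀ a, 2 ≤ (initSupport v (f a) w).card := fun a => by
      rw [← Finset.card_pair (hne a)]
      exact Finset.card_le_card (hsub a)
    -- The point `w` might lie on the boundary of `σ a`, where more terms are minimal; at least 2 in
    -- each of d sets and at most 2d in total rules this out.
    have htotal := sum_card_lowerSet_le hfine w
    have hge : ∑ _a : ι, 2 ≤ ∑ a, (initSupport v (f a) w).card :=
      Finset.sum_le_sum fun a _ => hcard a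
    have h2 : ∑ _a : ι, 2 = 2 * Fintype.card ι := by simp [mul_comm]
    have := (Finset.sum_eq_sum_iff_of_le fun a _ => hcard a).1
      (le_antisymm hge (htotal.trans_eq h2.symm)) a (Finset.mem_univ a)
    refine (Finset.eq_of_subset_of_card_le (hsub a) ?_).symm
    rw [← this, Finset.card_pair (hne a)]
  -- A kernel vector is orthogonal to every edge, so it lies in all the hyperplanes, whose
  -- intersection is 0.
  · obtain ⟨x, hx, hMx⟩ := Matrix.exists_mulVec_eq_zero_iff.2 hdet
    refine hx ((Submodule.mem_bot ℝ).1 (hinf ▸ (Submodule.mem_iInf _).2 fun a => ?_))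
    rw [hspan a]
    exact congrFun hMx a

end Cells

/-! ### Cells and cycle covers of the polynomial graph. -/

section Game

variable {N : ℕ} {k : Fin N → ℕ} {K : Type*} [Field K]

theorem involves_segment {x y : Space k} {b : Idx k} :
    Involves (segment ℝ x y) b ↔ x b ≠ y b := by
  constructor
  · rintro ⟨z, ⟨s, t, hs, ht, hst, rfl⟩, z', ⟨s', t', hs', ht', hst', rfl⟩, hne⟩ h
    refine hne ?_
    simp only [Pi.add_apply, Pi.smul_apply, smul_eq_mul, h, ← add_mul, hst, hst']
  · exact fun h => ⟨x, left_mem_segment ℝ x y, y, right_mem_segment ℝ x y, h⟩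

theorem sum_opponents_stratExp_zero (O : Finset (Fin N)) :
    ∑ j ∈ O, stratExp (k := k) j 0 = 0 :=
  Finset.sum_eq_zero fun _ _ => rfl

theorem IsGeneric.zero_mem_support {v : AddValuation K (WithTop ℝ)} {g : NetworkGame N k K}
    (hg : IsGeneric v g) (a : Idx k) : 0 ∈ (indifference g a).support := by
  have := hg.coeff_ne_zero a (fun _ => 0)
  rw [sum_opponents_stratExp_zero] at this
  exact mem_support_iff.2 this

theorem IsGeneric.single_mem_support {v : AddValuation K (WithTop ℝ)} {g : NetworkGame N k K}
    (hg : IsGeneric v g) (a b : Idx k) (hb : b.1 ∈ opponents g a.1) :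
    Finsupp.single b 1 ∈ (indifference g a).support := by
  classical
  have := hg.coeff_ne_zero a (Function.update (fun _ => 0) b.1 b.2.succ)
  rw [Finset.sum_eq_single_of_mem b.1 hb, Function.update_self] at this
  · exact mem_support_iff.2 this
  · intro j _ hj
    rw [Function.update_of_ne hj]
    rfl

/-- Makes a cycle cover respect the network: every arc leads from a player's block to that of an
opponent. -/
theorem fst_mem_opponents_of_adj {g : NetworkGame N k K} {a b : Idx k}
    (h : (polyGraph g).Adj a b) : b.1 ∈ opponents g a.1 := by
  obtain ⟨u, hu, hb⟩ := (mem_vars_iff_mem_support b).1 h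
  obtain ⟨p, rfl⟩ := exists_of_mem_support_indifference g a hu
  rw [Finsupp.mem_support_iff, sum_stratExp_apply] at hb
  by_contra hn
  exact hb (by simp [hn])

theorem toPoint_zero {ι : Type*} : toPoint (0 : ι →₀ ℕ) = 0 := by
  funext a; simp [toPoint]

theorem toPoint_single {ι : Type*} [DecidableEq ι] (b : ι) :
    toPoint (Finsupp.single b 1) = Pi.single b 1 := by
  funext a
  simp [toPoint, Finsupp.single_apply, Pi.single_apply, eq_comm]

/-- The edge from the origin to `e_b` is the face of the Newton polytope of `f_a` on which all
coordinates but `b` vanish. -/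
theorem IsGeneric.face_newtonPolytope {v : AddValuation K (WithTop ℝ)} {g : NetworkGame N k K}
    (hg : IsGeneric v g) (a b : Idx k) (hb : b.1 ∈ opponents g a.1) :
    segment ℝ (0 : Space k) (Pi.single b 1) =
      face (fun c => if c = b then 0 else 1) (newtonPolytope (indifference g a)) := by
  set P := newtonPolytope (indifference g a)
  set w : Space k := fun c => if c = b then 0 else 1
  have h0 : (0 : Space k) ∈ P := subset_convexHull ℝ _ ⟨0, hg.zero_mem_support a, toPoint_zero⟩
  have h1 : (Pi.single b 1 : Space k) ∈ P :=
    subset_convexHull ℝ _ ⟨_, hg.single_mem_support a b hb, toPoint_single b⟩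
  -- Inside the unit cube the weight is nonnegative, and it vanishes only on the segment from 0 to
  -- `e_b`.
  have hbox : P ⊆ Set.Icc 0 1 := by
    refine convexHull_min ?_ (convex_Icc 0 1)
    rintro _ ⟨u, hu, rfl⟩
    refine ⟨fun c => Nat.cast_nonneg _, fun c => ?_⟩
    exact Nat.cast_le_one.2 (apply_le_one_of_mem_support g a hu c)
  have hw : ∀ x ∈ P, 0 ≤ w ⬝ᵥ x := fun x hx => Finset.sum_nonneg fun c _ =>
    mul_nonneg (by dsimp only [w]; split_ifs <;> simp) ((hbox hx).1 c)
  ext x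
  constructor
  · intro hx
    refine ⟨(convex_convexHull ℝ _).segment_subset h0 h1 hx, fun y hy => ?_⟩
    obtain ⟨s, t, hs, ht, hst, rfl⟩ := hx
    refine le_of_eq_of_le ?_ (hw y hy)
    simp [w]
  · rintro ⟨hxP, hx⟩
    have hx0 : w ⬝ᵥ x = 0 := le_antisymm (by simpa using hx 0 h0) (hw x hxP)
    have hc : ∀ c, c ≠ b → x c = 0 := fun c hcb => by
      have := (Finset.sum_eq_zero_iff_of_nonneg fun c _ =>
        mul_nonneg (by dsimp only [w]; split_ifs <;> simp) ((hbox hxP).1 c)).1 hx0 c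
          (Finset.mem_univ c)
      simpa [w, hcb] using this
    refine ⟨1 - x b, x b, sub_nonneg.2 ((hbox hxP).2 b), (hbox hxP).1 b, by ring, ?_⟩
    funext c
    by_cases hcb : c = b
    · subst hcb; simp
    · simp [hcb, hc c hcb]

theorem exists_perm_of_mem_stableIntersection {v : AddValuation K (WithTop ℝ)}
    {g : NetworkGame N k K} (hg : IsGeneric v g) {w : Space k}
    (hw : w ∈ stableIntersection v (indifference g)) :
    IsFullMixedCell (fun a => (indifference g a).support)
        (fun a => valHeight v (indifference g a)) (fun a => initFace v (indifference g a) w) ∧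
      (∀ a, dim (initFace v (indifference g a) w) = 1) ∧
      (∃ C : Equiv.Perm (Idx k), IsCycleCover (polyGraph g) C ∧
        ∀ a, Involves (initFace v (indifference g a) w) (C a)) ∧
      ((∀ a, InSingleBlock (initFace v (indifference g a) w)) →
        ∃! C : Equiv.Perm (Idx k), IsCycleCover (polyGraph g) C ∧
          ∀ a, Involves (initFace v (indifference g a) w) (C a)) := by
  obtain ⟨u, u', hpair, hdet⟩ := exists_edges_of_mem_stableIntersection hg.fine hw
  set M : Matrix (Idx k) (Idx k) ℝ := Matrix.of fun a => toPoint (u' a) - toPoint (u a)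
  have hli : LinearIndependent ℝ M := Matrix.linearIndependent_rows_of_det_ne_zero hdet
  have hface : ∀ a, initFace v (indifference g a) w =
      segment ℝ (toPoint (u a)) (toPoint (u' a)) := fun a => by
    refine lowerFace_eq_segment fun x => ?_
    change x ∈ initSupport v (indifference g a) w ↔ _
    rw [hpair a]
    simp
  have hu : ∀ a, u a ∈ (indifference g a).support := fun a =>
    (mem_lowerSet.1 (show u a ∈ initSupport v (indifference g a) w by simp [hpair a])).1
  have hu' : ∀ a, u' a ∈ (indifference g a).support := fun a =>
    (mem_lowerSet.1 (show u' a ∈ initSupport v (indifference g a) w by simp [hpair a])).1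
  have hM : ∀ a b, M a b = (u' a b : ℝ) - u a b := fun a b => rfl
  have hM0 : ∀ a b, M a b ≠ 0 ↔ u a b ≠ u' a b := fun a b => by
    rw [hM, sub_ne_zero, Ne, Nat.cast_inj, eq_comm]
  have hinv : ∀ a b, Involves (initFace v (indifference g a) w) b ↔ M a b ≠ 0 := fun a b => by
    rw [hface, involves_segment, hM0]
    simp [toPoint]
  have hex : ∃ C : Equiv.Perm (Idx k), IsCycleCover (polyGraph g) C ∧
      ∀ a, Involves (initFace v (indifference g a) w) (C a) := by
    obtain ⟨C, hC⟩ := exists_perm_of_det_ne_zero hdet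
    refine ⟨C, fun a => ?_, fun a => (hinv a _).2 (hC a)⟩
    change C a ∈ (indifference g a).vars
    rw [mem_vars_iff_mem_support]
    -- A coordinate that differs at the two ends is non-zero at one of them, so its variable appears
    -- in the polynomial.
    by_cases h : u a (C a) = 0
    · refine ⟨u' a, hu' a, Finsupp.mem_support_iff.2 fun h' => ?_⟩
      exact (hM0 a _).1 (hC a) (h.trans h'.symm)
    · exact ⟨u a, hu a, Finsupp.mem_support_iff.2 h⟩
  refine ⟨⟨⟨w, fun a => rfl⟩, ?_⟩, fun a => ?_, hex, fun hblock => ?_⟩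
  · simp only [hface]
    exact dim_sum_segment_of_linearIndependent hli
  · rw [hface]
    exact dim_segment (sub_ne_zero.1 (hli.ne_zero a)).symm
  · obtain ⟨C, hC⟩ := hex
    refine ⟨C, hC, fun C' hC' => perm_eq_of_rows hli (fun a b c hbc hb hc => ?_)
      (fun a => (hinv a _).1 (hC'.2 a)) (fun a => (hinv a _).1 (hC.2 a))⟩
    obtain ⟨j, hj⟩ := hblock a
    rw [hface] at hj
    have hj' : ∀ b : Idx k, b.1 ≠ j → u a b = u' a b := fun b hb => by
      have := hj _ (left_mem_segment ℝ _ _) _ (right_mem_segment ℝ _ _) b hb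
      simpa [toPoint] using this
    obtain ⟨h1, h2⟩ := apply_sub_apply_of_same_block g a (hu a) (hu' a) hj' hbc
      ((hM0 a b).1 hb) ((hM0 a c).1 hc)
    exact ⟨h1, fun e heb hec => by rw [hM, h2 e heb hec, sub_self]⟩

theorem IsGeneric.exists_cell_of_isCycleCover {v : AddValuation K (WithTop ℝ)}
    {g : NetworkGame N k K} (hg : IsGeneric v g) {C : Equiv.Perm (Idx k)}
    (hC : IsCycleCover (polyGraph g) C) :
    ∃ F : Idx k → Set (Space k),
      (∀ a, IsAdmissibleFace g a.1 (C a).1 0 (C a).2.succ (F a) ∧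
        (∃ w, F a = face w (newtonPolytope (indifference g a))) ∧ dim (F a) = 1) ∧
      ∃ h : Idx k → (Idx k →₀ ℕ) → ℝ,
        IsFullMixedCell (fun a => (indifference g a).support) h F := by
  have hopp : ∀ a, (C a).1 ∈ opponents g a.1 := fun a => fst_mem_opponents_of_adj (hC a)
  -- All blocks other than that of `C a` contribute the vertex 0. With heights 0 on the two
  -- endpoints and 1 elsewhere, the weight 0 cuts out all the edges at once.
  refine ⟨fun a => segment ℝ 0 (Pi.single (C a) 1), fun a => ⟨⟨hopp a,
    (Fin.succ_ne_zero _).symm, fun _ => 0, ?_⟩, ⟨_, hg.face_newtonPolytope a (C a) (hopp a)⟩, ?_⟩,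
    fun a u => if u = 0 ∨ u = Finsupp.single (C a) 1 then 0 else 1, ⟨0, fun a => ?_⟩, ?_⟩
  · have h1 : toPoint (stratExp (k := k) (C a).1 0) = 0 := toPoint_zero
    have h2 : toPoint (stratExp (k := k) (C a).1 (C a).2.succ) = Pi.single (C a) 1 :=
      toPoint_single (C a)
    have h3 : ∑ j ∈ (opponents g a.1).erase (C a).1, toPoint (stratExp (k := k) j 0) = 0 :=
      Finset.sum_eq_zero fun _ _ => toPoint_zero
    rw [h1, h2, h3, Set.singleton_zero, add_zero]
  · refine dim_segment fun h => ?_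
    simpa using congrFun h (C a)
  · dsimp only
    rw [lowerFace_eq_segment (u := 0) (u' := Finsupp.single (C a) 1), toPoint_zero,
      toPoint_single]
    intro x
    simp only [mem_lowerSet, zero_dotProduct, add_zero]
    constructor
    · rintro ⟨-, hx⟩
      have := hx 0 (hg.zero_mem_support a)
      by_contra hn
      rw [if_neg hn, if_pos (Or.inl rfl)] at this
      norm_num at this
    · intro hx
      refine ⟨?_, fun y _ => ?_⟩
      · rcases hx with rfl | rfl
        · exact hg.zero_mem_support a
        · exact hg.single_mem_support a _ (hopp a)
      · rw [if_pos hx]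
        split_ifs <;> norm_num
  · refine dim_sum_segment_of_linearIndependent (x := fun _ => 0) ?_
    simp only [sub_zero]
    exact (Pi.linearIndependent_single_one (Idx k) ℝ).comp C C.injective

end Game

end TropicalGame

theorem mainTheorem2 {N : ℕ} {k : Fin N → ℕ} {K : Type*} [Field K]
    (v : AddValuation K (WithTop ℝ)) (g : TropicalGame.NetworkGame N k K)
    (hg : TropicalGame.IsGeneric v g) :
    (∀ w ∈ TropicalGame.stableIntersection v (TropicalGame.indifference g),
      TropicalGame.IsFullMixedCell (fun a => (TropicalGame.indifference g a).support)
        (fun a => TropicalGame.valHeight v (TropicalGame.indifference g a))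
        (fun a => TropicalGame.initFace v (TropicalGame.indifference g a) w) ∧
      (∀ a, TropicalGame.dim (TropicalGame.initFace v (TropicalGame.indifference g a) w) = 1) ∧
      (∃ C : Equiv.Perm (TropicalGame.Idx k),
        TropicalGame.IsCycleCover (TropicalGame.polyGraph g) C ∧
        ∀ a, TropicalGame.Involves
          (TropicalGame.initFace v (TropicalGame.indifference g a) w) (C a)) ∧
      ((∀ a, TropicalGame.InSingleBlock
          (TropicalGame.initFace v (TropicalGame.indifference g a) w)) →
        ∃! C : Equiv.Perm (TropicalGame.Idx k),
          TropicalGame.IsCycleCover (TropicalGame.polyGraph g) C ∧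
          ∀ a, TropicalGame.Involves
            (TropicalGame.initFace v (TropicalGame.indifference g a) w) (C a))) ∧
    (∀ C : Equiv.Perm (TropicalGame.Idx k),
      TropicalGame.IsCycleCover (TropicalGame.polyGraph g) C →
      ∃ F : TropicalGame.Idx k → Set (TropicalGame.Space k),
        (∀ a, TropicalGame.IsAdmissibleFace g a.1 (C a).1 0 (C a).2.succ (F a) ∧
          (∃ w, F a = TropicalGame.face w
            (TropicalGame.newtonPolytope (TropicalGame.indifference g a))) ∧
          TropicalGame.dim (F a) = 1) ∧
        ∃ h : TropicalGame.Idx k → (TropicalGame.Idx k →₀ ℕ) → ℝ,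
          TropicalGame.IsFullMixedCell (fun a => (TropicalGame.indifference g a).support) h F) :=
  ⟨fun _ hw => TropicalGame.exists_perm_of_mem_stableIntersection hg hw,
    fun _ hC => hg.exists_cell_of_isCycleCover hC⟩
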